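/- Let $X$ be a Hausdorff complex topological vector space that is locally convex or, more generally, locally pseudo-convex (it has a base of zero neighborhoods $U$ with $U+U\subseteq\alpha U$ for some $\alpha>0$ depending on $U$); no completeness is assumed. Let $K\colon X\to X$ be a compact linear operator, i.e. $K$ maps some zero neighborhood into a set with compact closure. Then $r(K)=|\sigma(K)|$, where $|\sigma(K)|=\sup\{|\lambda| : \lambda\in\sigma(K)\}$ (with $\sup\emptyset=0$) and $\sigma(K)$ and $r(K)$ are defined as follows. Call a linear operator $T$ on $X$ bb-bounded if it maps bounded sets to bounded sets, nn-bounded if there is a base $\mathcal N_0$ of zero neighborhoods such that every $U\in\mathcal N_0$ satisfies $T(U)\subseteq\alpha U$ for some $\alpha>0$, and nb-bounded if it maps some zero neighborhood to a bounded set. (Bases of zero neighborhoods consist of balanced sets and are closed under multiplication by nonzero scalars.) Let $\sigma^{bb}(K)$, $\sigma^{c}(K)$, $\sigma^{nn}(K)$, $\sigma^{nb}(K)$ be the set of all $\lambda\in\mathbb C$ for which $\lambda I-K$ does not have a two-sided linear inverse that is, respectively, bb-bounded, continuous, nn-bounded, or of the form $\alpha I+S$ with $\alpha\in\mathbb C$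 and $S$ nb-bounded. Let $r_{bb}(K)$, $r_c(K)$, $r_{nn}(K)$, $r_{nb}(K)$ be the infimum in $[0,\infty]$ of all $\nu>0$ such that $S_n=K^n/\nu^n$ tends to zero, respectively, - uniformly on every bounded set; - equicontinuously: for every zero neighborhood $V$ there is a zero neighborhood $U$ such that for every $\varepsilon>0$ one has $S_n(U)\subseteq\varepsilon V$ for all large $n$; - in the sense of nn-convergence: there is a base $\mathcal N_0$ of zero neighborhoods such that for all $U\in\mathcal N_0$ and $\varepsilon>0$ one has $S_n(U)\subseteq\varepsilon U$ for all large $n$; - uniformly on some zero neighborhood. Then $\sigma^{bb}(K)=\sigma^{c}(K)=\sigma^{nn}(K)=\sigma^{nb}(K)$, and this common set is $\sigma(K)$; also $r_{bb}(K)=r_c(K)=r_{nn}(K)=r_{nb}(K)$, and this common number is $r(K)$; and $r(K)=|\sigma(K)|$. -/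

import Mathlib

namespace TVSOp

open Filter Set
open scoped Topology Pointwise ENNReal

section Space

variable {X : Type*} [AddCommGroup X] [Module ℂ X]

/-- A set `A` is pseudo-convex if `A + A ⊆ α A` for some number `α`. -/
def IsPseudoconvex (A : Set X) : Prop :=
  ∃ α : ℝ, 0 < α ∧ A + A ⊆ (α : ℂ) • A

variable [TopologicalSpace X]

variable (X) in
/-- The zero neighborhoods have a base that consists of pseudo-convex sets. -/
def LocallyPseudoconvex : Prop :=
  ∀ V ∈ 𝓝 (0 : X), ∃ U ∈ 𝓝 (0 : X), U ⊆ V ∧ IsPseudoconvex U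

/-- A base of balanced zero neighborhoods that is stable under multiplication by nonzero scalars.
The two other usual requirements on such a base are consequences, see `IsZeroBase.exists_inter`
and `IsZeroBase.exists_add` below. -/
structure IsZeroBase (B : Set (Set X)) : Prop where
  mem_nhds : ∀ U ∈ B, U ∈ 𝓝 (0 : X)
  exists_subset : ∀ V ∈ 𝓝 (0 : X), ∃ U ∈ B, U ⊆ V
  balanced : ∀ U ∈ B, Balanced ℂ U
  smul_mem : ∀ U ∈ B, ∀ c : ℂ, c ≠ 0 → c • U ∈ B

theorem IsZeroBase.exists_inter {B : Set (Set X)} (hB : IsZeroBase B) {U V : Set X}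
    (hU : U ∈ B) (hV : V ∈ B) : ∃ W ∈ B, W ⊆ U ∩ V :=
  hB.exists_subset _ (inter_mem (hB.mem_nhds U hU) (hB.mem_nhds V hV))

theorem IsZeroBase.exists_add [IsTopologicalAddGroup X] {B : Set (Set X)} (hB : IsZeroBase B)
    {V : Set X} (hV : V ∈ B) : ∃ U ∈ B, U + U ⊆ V := by
  obtain ⟨W, hW, h⟩ := exists_nhds_zero_half (hB.mem_nhds V hV)
  obtain ⟨U, hU, hUW⟩ := hB.exists_subset W hW
  refine ⟨U, hU, ?_⟩
  rintro _ ⟨a, ha, b, hb, rfl⟩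
  exact h a (hUW ha) b (hUW hb)

end Space

section Operators

variable {X : Type*} [AddCommGroup X] [Module ℂ X] [TopologicalSpace X]

/-! Four classes of linear operators. -/

/-- `T` maps bounded sets to bounded sets. -/
def BBBounded (T : Module.End ℂ X) : Prop :=
  ∀ A : Set X, Bornology.IsVonNBounded ℂ A → Bornology.IsVonNBounded ℂ (T '' A)

/-- `T` maps every member of some base of zero neighborhoods into a multiple of itself. -/
def NNBounded (T : Module.End ℂ X) : Prop :=
  ∃ B : Set (Set X), IsZeroBase B ∧ ∀ U ∈ B, ∃ α : ℝ, 0 < α ∧ T '' U ⊆ (α : ℂ) • U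

/-- `T` maps some zero neighborhood to a bounded set. -/
def NBBounded (T : Module.End ℂ X) : Prop :=
  ∃ U ∈ 𝓝 (0 : X), Bornology.IsVonNBounded ℂ (T '' U)

/-- `T` belongs to the unitalization of the algebra of nb-bounded operators. -/
def NBBoundedModScalar (T : Module.End ℂ X) : Prop :=
  ∃ (α : ℂ) (S : Module.End ℂ X), NBBounded S ∧ T = α • 1 + S

/-! The corresponding spectra. -/

/-- The complement of the set of all `z` such that `zI - T` has a two-sided linear inverse
that belongs to the class `P`. -/
def spectrumIn {X : Type*} [AddCommGroup X] [Module ℂ X]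
    (P : Module.End ℂ X → Prop) (T : Module.End ℂ X) : Set ℂ :=
  {z : ℂ | ∃ R : Module.End ℂ X, R * (z • 1 - T) = 1 ∧ (z • 1 - T) * R = 1 ∧ P R}ᶜ

def spectrumBB (T : Module.End ℂ X) : Set ℂ := spectrumIn BBBounded T

def spectrumC (T : Module.End ℂ X) : Set ℂ := spectrumIn (fun R => Continuous R) T

def spectrumNN (T : Module.End ℂ X) : Set ℂ := spectrumIn NNBounded T

def spectrumNB (T : Module.End ℂ X) : Set ℂ := spectrumIn NBBoundedModScalar T

/-- The geometrical radius `sup {|z| : z ∈ s}` of a set of complex numbers; it is `0` for the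
empty set. -/
noncomputable def geomRadius (s : Set ℂ) : ℝ≥0∞ := ⨆ z ∈ s, ‖z‖ₑ

/-! Modes of convergence to zero of a sequence of operators. -/

/-- `S n` tends to zero uniformly on `A`. -/
def UnifNullOn (S : ℕ → Module.End ℂ X) (A : Set X) : Prop :=
  ∀ V ∈ 𝓝 (0 : X), ∀ᶠ n in atTop, S n '' A ⊆ V

/-- `S n` tends to zero uniformly on every bounded set. -/
def BBNull (S : ℕ → Module.End ℂ X) : Prop :=
  ∀ A : Set X, Bornology.IsVonNBounded ℂ A → UnifNullOn S A

/-- `S n` tends to zero equicontinuously. -/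
def EquicontNull (S : ℕ → Module.End ℂ X) : Prop :=
  ∀ V ∈ 𝓝 (0 : X), ∃ U ∈ 𝓝 (0 : X), ∀ ε : ℝ, 0 < ε →
    ∀ᶠ n in atTop, S n '' U ⊆ (ε : ℂ) • V

/-- `S n` nn-converges to zero. -/
def NNNull (S : ℕ → Module.End ℂ X) : Prop :=
  ∃ B : Set (Set X), IsZeroBase B ∧ ∀ U ∈ B, ∀ ε : ℝ, 0 < ε →
    ∀ᶠ n in atTop, S n '' U ⊆ (ε : ℂ) • U

/-- `S n` tends to zero uniformly on some zero neighborhood. -/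
def NBNull (S : ℕ → Module.End ℂ X) : Prop :=
  ∃ U ∈ 𝓝 (0 : X), UnifNullOn S U

/-! The corresponding spectral radii, with values in `[0, ∞]`. -/

/-- The infimum in `[0, ∞]` of all real `ν > 0` such that the sequence `T ^ n / ν ^ n` tends to
zero in the sense of `C`. -/
noncomputable def radiusIn {X : Type*} [AddCommGroup X] [Module ℂ X]
    (C : (ℕ → Module.End ℂ X) → Prop) (T : Module.End ℂ X) : ℝ≥0∞ :=
  sInf (ENNReal.ofReal '' {ν : ℝ | 0 < ν ∧ C (fun n => ((ν : ℂ) ^ n)⁻¹ • T ^ n)})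

noncomputable def radiusBB (T : Module.End ℂ X) : ℝ≥0∞ := radiusIn BBNull T

noncomputable def radiusC (T : Module.End ℂ X) : ℝ≥0∞ := radiusIn EquicontNull T

noncomputable def radiusNN (T : Module.End ℂ X) : ℝ≥0∞ := radiusIn NNNull T

noncomputable def radiusNB (T : Module.End ℂ X) : ℝ≥0∞ := radiusIn NBNull T

end Operators

end TVSOp

/-!
Let `K` be nb-bounded and `U` a balanced pseudo-convex zero neighborhood with `K U` bounded. The
operators that map `U` into itself play the role of a unit ball: gauging the powers of an operator
by multiples of this ball gives its growth rate. The ball is only pseudo-convex, but adding `n`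
terms costs a factor polynomial in `n`, so on commuting operators that the ball absorbs the growth
rate is a submultiplicative seminorm. The absorbed part of the bicommutant of `K` contains the
resolvent of `K`, because `R = z⁻¹ (1 + R K)`, and Gelfand's formula in its Banach algebra
completion yields `r(K) ≤ |σ(K)|`.

Conversely, if `K ^ n / ν ^ n` tends to zero and `|z| > ν`, some power of `K / z` contracts a zero
neighborhood. Then the partial sums of the Neumann series stay in a compact set, and a cluster point
replaces the sum that the incomplete space may lack, so `z` lies outside `σ(K)`.
-/

namespace TVSOp

open Bornology Filter Set
open scoped Topology Pointwise ENNReal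

section ScaledSets

variable {E : Type*} [AddCommGroup E] [Module ℂ E] {U : Set E}

theorem smul_subset_smul (hU : Balanced ℂ U) {c d : ℝ} (hc : 0 ≤ c) (h : c ≤ d) :
    (c : ℂ) • U ⊆ (d : ℂ) • U :=
  hU.smul_mono (by
    rwa [Complex.norm_real, Complex.norm_real, Real.norm_of_nonneg hc,
      Real.norm_of_nonneg (hc.trans h)])

theorem smul_mem_smul (hU : Balanced ℂ U) {z : ℂ} {c : ℝ} (h : ‖z‖ ≤ c) {x : E} (hx : x ∈ U) :
    z • x ∈ (c : ℂ) • U :=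
  hU.smul_mono (by rwa [Complex.norm_real, Real.norm_of_nonneg ((norm_nonneg z).trans h)])
    (smul_mem_smul_set hx)

theorem exists_subset_smul_of_absorbs {A : Set E} (h : Absorbs ℂ U A) :
    ∃ c : ℝ, 0 < c ∧ A ⊆ (c : ℂ) • U := by
  obtain ⟨c, hc, h⟩ := h.exists_pos
  exact ⟨c, hc, h c (by rw [Complex.norm_real, Real.norm_of_nonneg hc.le])⟩

theorem absorbs_of_subset_smul (hU : Balanced ℂ U) {A : Set E} {c : ℝ} (h : A ⊆ (c : ℂ) • U) :
    Absorbs ℂ U A :=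
  absorbs_iff_norm.2 ⟨‖(c : ℂ)‖, fun _ hz => h.trans (hU.smul_mono hz)⟩

theorem add_mem_smul {α : ℝ} (hα : U + U ⊆ (α : ℂ) • U) {c : ℝ} {x y : E}
    (hx : x ∈ (c : ℂ) • U) (hy : y ∈ (c : ℂ) • U) : x + y ∈ ((α * c : ℝ) : ℂ) • U := by
  have h : (c : ℂ) • (U + U) ⊆ (c : ℂ) • (α : ℂ) • U := smul_set_mono hα
  rw [smul_add, smul_smul, ← Complex.ofReal_mul, mul_comm c α] at h
  exact h (add_mem_add hx hy)

theorem sum_range_two_pow_mem_smul {α : ℝ} (hα : U + U ⊆ (α : ℂ) • U) {c : ℝ} (k : ℕ)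
    {f : ℕ → E} (hf : ∀ i, f i ∈ (c : ℂ) • U) :
    ∑ i ∈ Finset.range (2 ^ k), f i ∈ ((α ^ k * c : ℝ) : ℂ) • U := by
  induction k generalizing f with
  | zero => simpa using hf 0
  | succ k ih =>
    rw [pow_succ 2 k, mul_two, Finset.sum_range_add, pow_succ' α, mul_assoc]
    exact add_mem_smul hα (ih hf) (ih fun i => hf _)

/-- Halving the index range repeatedly makes the constant polynomial in `n`; adding the terms one
by one would give an exponential constant. -/
theorem sum_range_mem_smul (h0 : (0 : E) ∈ U) {α : ℝ} (hα : U + U ⊆ (α : ℂ) • U) {c : ℝ} {n : ℕ}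
    {f : ℕ → E} (hf : ∀ i < n, f i ∈ (c : ℂ) • U) :
    ∑ i ∈ Finset.range n, f i ∈ ((α ^ n.size * c : ℝ) : ℂ) • U := by
  have hsum : ∑ i ∈ Finset.range n, f i =
      ∑ i ∈ Finset.range (2 ^ n.size), if i < n then f i else 0 := by
    rw [← Finset.sum_filter]
    congr 1
    ext i
    simpa using fun hi => hi.trans (Nat.lt_size_self n)
  rw [hsum]
  refine sum_range_two_pow_mem_smul hα _ fun i => ?_
  split_ifs with hi
  · exact hf i hi
  · exact zero_mem_smul_set h0

theorem two_pow_size_succ_le (n : ℕ) : 2 ^ (n + 1).size ≤ 2 * (n + 1) := by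
  obtain ⟨k, hk⟩ := Nat.exists_eq_succ_of_ne_zero (Nat.size_pos.2 n.succ_pos).ne'
  have : 2 ^ k ≤ n + 1 := Nat.lt_size.1 (hk ▸ k.lt_succ_self)
  rw [hk, Nat.succ_eq_add_one, pow_succ]
  omega

theorem exists_pow_size_succ_mul_pow_le {α : ℝ} (hα : 0 ≤ α) {t : ℝ} (ht : 0 < t) (ht1 : t < 1) :
    ∃ C : ℝ, 0 < C ∧ ∀ n : ℕ, α ^ (n + 1).size * t ^ n ≤ C := by
  obtain ⟨m, hm⟩ := pow_unbounded_of_one_lt α one_lt_two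
  have hlim : Tendsto (fun n : ℕ => (n : ℝ) ^ m * t ^ n) atTop (𝓝 0) :=
    tendsto_pow_const_mul_const_pow_of_abs_lt_one m (by rwa [abs_of_pos ht])
  obtain ⟨C, hC⟩ := hlim.bddAbove_range
  have hC' : ∀ n : ℕ, ((n : ℝ) + 1) ^ m * t ^ (n + 1) ≤ C := fun n => by
    exact_mod_cast hC (mem_range_self (n + 1))
  have hC0 : 0 < C := lt_of_lt_of_le (by simpa using ht) (hC' 0)
  refine ⟨2 ^ m * (C / t), by positivity, fun n => ?_⟩
  have hsize : (2 : ℝ) ^ (n + 1).size ≤ 2 * (n + 1) := by exact_mod_cast two_pow_size_succ_le n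
  calc α ^ (n + 1).size * t ^ n ≤ (2 ^ m) ^ (n + 1).size * t ^ n := by gcongr
    _ = (2 ^ (n + 1).size) ^ m * t ^ n := by rw [← pow_mul, ← pow_mul, mul_comm m]
    _ ≤ (2 * (n + 1)) ^ m * t ^ n := by gcongr
    _ = 2 ^ m * ((((n : ℝ) + 1) ^ m * t ^ (n + 1)) / t) := by
      rw [mul_pow, pow_succ]
      field_simp
    _ ≤ 2 ^ m * (C / t) := by gcongr; exact hC' n

theorem balanced_preimage {F : Type*} [AddCommGroup F] [Module ℂ F] (hU : Balanced ℂ U)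
    (f : F →ₗ[ℂ] E) : Balanced ℂ (f ⁻¹' U) :=
  hU.mulActionHom_preimage f.toMulActionHom

theorem IsPseudoconvex.preimage {F : Type*} [AddCommGroup F] [Module ℂ F] (hU : IsPseudoconvex U)
    (f : F →ₗ[ℂ] E) : IsPseudoconvex (f ⁻¹' U) := by
  obtain ⟨α, hα, h⟩ := hU
  have hα' : (α : ℂ) ≠ 0 := by exact_mod_cast hα.ne'
  refine ⟨α, hα, ?_⟩
  rintro _ ⟨x, hx, y, hy, rfl⟩
  have : f (x + y) ∈ (α : ℂ) • U := map_add f x y ▸ h (add_mem_add hx hy)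
  rw [mem_smul_set_iff_inv_smul_mem₀ hα'] at this ⊢
  rwa [mem_preimage, map_smul]

theorem absorbent_preimage {F : Type*} [AddCommGroup F] [Module ℂ F] (f : F →ₗ[ℂ] E)
    (h : ∀ x, Absorbs ℂ U {f x}) : Absorbent ℂ (f ⁻¹' U) := by
  intro x
  simpa [absorbs_iff_eventually_nhdsNE_zero] using h x

end ScaledSets

section Growth

variable {A : Type*} [Ring A] [Algebra ℂ A] {B : Submonoid A} {a b : A} {ν μ ρ : ℝ}

theorem mul_mem_smul {c d : ℂ} (ha : a ∈ c • (B : Set A)) (hb : b ∈ d • (B : Set A)) :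
    a * b ∈ (c * d) • (B : Set A) := by
  obtain ⟨x, hx, rfl⟩ := ha
  obtain ⟨y, hy, rfl⟩ := hb
  exact ⟨x * y, mul_mem hx hy, (smul_mul_smul_comm c x d y).symm⟩

/-- The powers of `a` grow at most like the powers of `ν`. Growth is measured by the multiples of
a multiplicatively closed set `B`, which plays the role of the unit ball of an operator norm. -/
def GrowthBound (B : Submonoid A) (a : A) (ν : ℝ) : Prop :=
  ∃ M : ℝ, 0 < M ∧ ∀ n : ℕ, a ^ n ∈ ((M * ν ^ n : ℝ) : ℂ) • (B : Set A)

namespace GrowthBound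

theorem of_mem_smul (h : a ∈ (ν : ℂ) • (B : Set A)) : GrowthBound B a ν := by
  refine ⟨1, one_pos, fun n => ?_⟩
  induction n with
  | zero => simp
  | succ n ih =>
    have := mul_mem_smul ih h
    rwa [← pow_succ, ← Complex.ofReal_mul, mul_assoc, ← pow_succ] at this

theorem mono (hB : Balanced ℂ (B : Set A)) (h : GrowthBound B a ν) (hν : 0 ≤ ν) (hle : ν ≤ μ) :
    GrowthBound B a μ := by
  obtain ⟨M, hM, h⟩ := h
  exact ⟨M, hM, fun n => smul_subset_smul hB (by positivity) (by gcongr) (h n)⟩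

theorem mul (hab : Commute a b) (ha : GrowthBound B a ν) (hb : GrowthBound B b μ) :
    GrowthBound B (a * b) (ν * μ) := by
  obtain ⟨M, hM, ha⟩ := ha
  obtain ⟨N, hN, hb⟩ := hb
  refine ⟨M * N, mul_pos hM hN, fun n => ?_⟩
  have := mul_mem_smul (ha n) (hb n)
  rwa [← hab.mul_pow, ← Complex.ofReal_mul, mul_mul_mul_comm, ← mul_pow] at this

theorem smul (hB : Balanced ℂ (B : Set A)) (h : GrowthBound B a ν) {z : ℂ} (hz : ‖z‖ ≤ μ) :
    GrowthBound B (z • a) (μ * ν) := by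
  have hz' : GrowthBound B (algebraMap ℂ A z) μ :=
    of_mem_smul (by
      rw [Algebra.algebraMap_eq_smul_one]
      exact smul_mem_smul hB hz B.one_mem)
  rw [Algebra.smul_def]
  exact hz'.mul (Algebra.commutes z a) h

theorem add (hB : Balanced ℂ (B : Set A)) (hp : IsPseudoconvex (B : Set A)) (hab : Commute a b)
    (ha : GrowthBound B a ν) (hb : GrowthBound B b μ) (hν : 0 < ν) (hμ : 0 < μ)
    (hρ : ν + μ < ρ) : GrowthBound B (a + b) ρ := by
  obtain ⟨M, hM, ha⟩ := ha
  obtain ⟨N, hN, hb⟩ := hb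
  obtain ⟨α, hα, hp⟩ := hp
  have hρ0 : 0 < ρ := by linarith
  obtain ⟨C, hC, hbd⟩ := exists_pow_size_succ_mul_pow_le hα.le (t := (ν + μ) / ρ) (by positivity)
    ((div_lt_one hρ0).2 hρ)
  refine ⟨C * (M * N), by positivity, fun n => ?_⟩
  have hterm : ∀ i < n + 1, a ^ i * b ^ (n - i) * (n.choose i : A) ∈
      ((M * N * (ν + μ) ^ n : ℝ) : ℂ) • (B : Set A) := by
    intro i hi
    have hab_mem := mul_mem_smul (ha i) (hb (n - i))
    have hchoose : (n.choose i : A) ∈ ((n.choose i : ℝ) : ℂ) • (B : Set A) :=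
      ⟨1, B.one_mem, by simp [← Algebra.algebraMap_eq_smul_one]⟩
    have hmem := mul_mem_smul hab_mem hchoose
    rw [← Complex.ofReal_mul, ← Complex.ofReal_mul] at hmem
    refine smul_subset_smul hB (by positivity) ?_ hmem
    have hle : ν ^ i * μ ^ (n - i) * (n.choose i) ≤ (ν + μ) ^ n := by
      rw [add_pow]
      exact Finset.single_le_sum (f := fun m => ν ^ m * μ ^ (n - m) * (n.choose m : ℝ))
        (fun m _ => by positivity) (Finset.mem_range.2 hi)
    calc M * ν ^ i * (N * μ ^ (n - i)) * (n.choose i : ℝ)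
        = M * N * (ν ^ i * μ ^ (n - i) * (n.choose i)) := by ring
      _ ≤ M * N * (ν + μ) ^ n := by gcongr
  rw [hab.add_pow]
  refine smul_subset_smul hB (by positivity) ?_
    (sum_range_mem_smul (hB.zero_mem ⟨1, B.one_mem⟩) hp hterm)
  calc α ^ (n + 1).size * (M * N * (ν + μ) ^ n)
      = M * N * (α ^ (n + 1).size * ((ν + μ) / ρ) ^ n) * ρ ^ n := by
        rw [div_pow]
        field_simp
    _ ≤ M * N * C * ρ ^ n := by gcongr; exact hbd n
    _ = C * (M * N) * ρ ^ n := by ring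

theorem of_pow (hA : Absorbent ℂ (B : Set A)) {n : ℕ} (hn : n ≠ 0) (hν : 0 < ν)
    (h : GrowthBound B (a ^ n) (ν ^ n)) : GrowthBound B a ν := by
  obtain ⟨M, hM, h⟩ := h
  obtain ⟨N, hN, hrem⟩ := exists_subset_smul_of_absorbs
    (hA.absorbs_finite ((finite_lt_nat n).image fun r => ((ν : ℂ) ^ r)⁻¹ • a ^ r))
  refine ⟨M * N, mul_pos hM hN, fun m => ?_⟩
  have hν' : (ν : ℂ) ^ (m % n) ≠ 0 := pow_ne_zero _ (by exact_mod_cast hν.ne')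
  have hr : a ^ (m % n) ∈ ((ν : ℂ) ^ (m % n) * N) • (B : Set A) := by
    rw [mul_smul, mem_smul_set_iff_inv_smul_mem₀ hν']
    exact hrem (mem_image_of_mem _ (Nat.mod_lt m (Nat.pos_of_ne_zero hn)))
  have hmem := mul_mem_smul (h (m / n)) hr
  rw [← pow_mul, ← pow_mul, ← pow_add, Nat.div_add_mod] at hmem
  convert hmem using 2
  push_cast
  rw [← Nat.div_add_mod m n, pow_add]
  simp only [Nat.div_add_mod]
  ring

end GrowthBound

theorem growthBound_comap {A' : Type*} [Ring A'] [Algebra ℂ A'] (f : A' →ₐ[ℂ] A) {a : A'}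
    (hν : 0 < ν) : GrowthBound (B.comap f) a ν ↔ GrowthBound B (f a) ν := by
  refine exists_congr fun M => and_congr_right fun hM => forall_congr' fun n => ?_
  have h : ((M * ν ^ n : ℝ) : ℂ) ≠ 0 := by exact_mod_cast (by positivity : M * ν ^ n ≠ 0)
  rw [mem_smul_set_iff_inv_smul_mem₀ h, mem_smul_set_iff_inv_smul_mem₀ h, ← map_pow,
    SetLike.mem_coe, Submonoid.mem_comap, map_smul, SetLike.mem_coe]

/-- The growth rate of the powers of `a`, measured by the multiples of `B`. -/
noncomputable def growthRadius (B : Submonoid A) (a : A) : ℝ :=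
  sInf {ν : ℝ | 0 < ν ∧ GrowthBound B a ν}

theorem growthRadius_nonneg (B : Submonoid A) (a : A) : 0 ≤ growthRadius B a :=
  Real.sInf_nonneg fun _ h => h.1.le

theorem growthRadius_le (hν : 0 < ν) (h : GrowthBound B a ν) : growthRadius B a ≤ ν :=
  csInf_le ⟨0, fun _ h => h.1.le⟩ ⟨hν, h⟩

section Absorbent

variable (hB : Balanced ℂ (B : Set A)) (hA : Absorbent ℂ (B : Set A))

include hB hA

theorem growthBound_of_growthRadius_lt (h : growthRadius B a < ν) : GrowthBound B a ν := by
  obtain ⟨c, hc, hac⟩ := exists_subset_smul_of_absorbs (hA a)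
  have hne : {μ : ℝ | 0 < μ ∧ GrowthBound B a μ}.Nonempty := ⟨c, hc, .of_mem_smul (hac rfl)⟩
  obtain ⟨μ, ⟨hμ, ha⟩, hlt⟩ := exists_lt_of_csInf_lt hne h
  exact ha.mono hB hμ.le hlt.le

theorem growthRadius_smul_le (z : ℂ) (a : A) : growthRadius B (z • a) ≤ ‖z‖ * growthRadius B a := by
  refine le_mul_of_forall_lt₀ fun c hc ν hν => ?_
  have hc0 : 0 < c := (norm_nonneg z).trans_lt hc
  have hν0 : 0 < ν := (growthRadius_nonneg B a).trans_lt hν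
  exact growthRadius_le (mul_pos hc0 hν0) ((growthBound_of_growthRadius_lt hB hA hν).smul hB hc.le)

theorem growthRadius_mul_le (hab : Commute a b) :
    growthRadius B (a * b) ≤ growthRadius B a * growthRadius B b := by
  refine le_mul_of_forall_lt₀ fun ν hν μ hμ => ?_
  have hν0 : 0 < ν := (growthRadius_nonneg B a).trans_lt hν
  have hμ0 : 0 < μ := (growthRadius_nonneg B b).trans_lt hμ
  exact growthRadius_le (mul_pos hν0 hμ0) ((growthBound_of_growthRadius_lt hB hA hν).mul hab
    (growthBound_of_growthRadius_lt hB hA hμ))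

theorem growthRadius_add_le (hp : IsPseudoconvex (B : Set A)) (hab : Commute a b) :
    growthRadius B (a + b) ≤ growthRadius B a + growthRadius B b := by
  refine le_of_forall_gt_imp_ge_of_dense fun ρ hρ => ?_
  obtain ⟨ν, hν, μ, hμ, hνμ⟩ : ∃ ν > growthRadius B a, ∃ μ > growthRadius B b, ν + μ < ρ := by
    refine ⟨growthRadius B a + (ρ - growthRadius B a - growthRadius B b) / 3, by linarith,
      growthRadius B b + (ρ - growthRadius B a - growthRadius B b) / 3, by linarith, by linarith⟩
  have hν0 : 0 < ν := (growthRadius_nonneg B a).trans_lt hν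
  have hμ0 : 0 < μ := (growthRadius_nonneg B b).trans_lt hμ
  exact growthRadius_le (by linarith) ((growthBound_of_growthRadius_lt hB hA hν).add hB hp hab
    (growthBound_of_growthRadius_lt hB hA hμ) hν0 hμ0 hνμ)

theorem growthRadius_neg_le (a : A) : growthRadius B (-a) ≤ growthRadius B a := by
  simpa using growthRadius_smul_le hB hA (-1) a

end Absorbent

end Growth

section SpectralRadiusFormula

/-- On a commutative algebra that is absorbed by a pseudo-convex multiplicatively closed set, the
growth radius is a submultiplicative seminorm. -/
noncomputable def growthSeminorm {A : Type*} [CommRing A] [Algebra ℂ A] {B : Submonoid A}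
    (hB : Balanced ℂ (B : Set A)) (hp : IsPseudoconvex (B : Set A))
    (hA : Absorbent ℂ (B : Set A)) : RingSeminorm A where
  toFun := growthRadius B
  map_zero' := by
    refine le_antisymm ?_ (growthRadius_nonneg B 0)
    simpa using growthRadius_smul_le hB hA 0 0
  add_le' a b := growthRadius_add_le hB hA hp (Commute.all a b)
  neg' a := by
    refine (growthRadius_neg_le hB hA a).antisymm ?_
    simpa using growthRadius_neg_le hB hA (-a)
  mul_le' a b := growthRadius_mul_le hB hA (Commute.all a b)

theorem exists_seminorm_pow_lt_of_spectralRadius_lt {A : Type*} [CommRing A] [Algebra ℂ A]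
    (p : RingSeminorm A) (hp : ∀ (z : ℂ) (a : A), p (z • a) ≤ ‖z‖ * p a) {a : A} {ρ : ℝ}
    (h : spectralRadius ℂ a < ENNReal.ofReal ρ) : ∃ n : ℕ, n ≠ 0 ∧ p (a ^ n) < ρ ^ n := by
  let : SeminormedCommRing A := { p.toSeminormedRing with mul_comm := mul_comm }
  let : NormedAlgebra ℂ A := { (inferInstance : Algebra ℂ A) with norm_smul_le := hp }
  let φ : A →ₐ[ℂ] UniformSpace.Completion A :=
    { UniformSpace.Completion.coeRingHom with commutes' := fun _ => rfl }
  have hφ : ∀ b, ‖φ b‖ = p b := UniformSpace.Completion.norm_coe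
  have hlt : spectralRadius ℂ (φ a) < ENNReal.ofReal ρ :=
    (biSup_mono fun _ hz => AlgHom.spectrum_apply_subset φ a hz).trans_lt h
  have hlim := spectrum.pow_norm_pow_one_div_tendsto_nhds_spectralRadius (φ a)
  obtain ⟨n, hn, hn0⟩ := ((hlim.eventually_lt_const hlt).and (eventually_ne_atTop 0)).exists
  rw [ENNReal.ofReal_lt_ofReal_iff (ENNReal.ofReal_pos.1 (bot_le.trans_lt h)), ← map_pow, hφ] at hn
  have hnonneg : 0 ≤ p (a ^ n) := apply_nonneg p _
  refine ⟨n, hn0, ?_⟩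
  calc p (a ^ n) = (p (a ^ n) ^ (1 / n : ℝ)) ^ n := by
        rw [one_div, Real.rpow_inv_natCast_pow hnonneg hn0]
    _ < ρ ^ n := pow_lt_pow_left₀ hn (Real.rpow_nonneg hnonneg _) hn0

open scoped IsMulCommutative in
theorem growthBound_of_spectralRadius_lt_of_absorbent {A : Type*} [Ring A] [IsMulCommutative A]
    [Algebra ℂ A] {B : Submonoid A} (hB : Balanced ℂ (B : Set A))
    (hp : IsPseudoconvex (B : Set A)) (hA : Absorbent ℂ (B : Set A)) {a : A} {ρ : ℝ}
    (h : spectralRadius ℂ a < ENNReal.ofReal ρ) : GrowthBound B a ρ := by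
  obtain ⟨n, hn, hlt⟩ := exists_seminorm_pow_lt_of_spectralRadius_lt (growthSeminorm hB hp hA)
    (growthRadius_smul_le hB hA) h
  exact .of_pow hA hn (ENNReal.ofReal_pos.1 (bot_le.trans_lt h))
    (growthBound_of_growthRadius_lt hB hA hlt)

variable {A : Type*} [Ring A] [Algebra ℂ A]

theorem spectralRadius_le_coe_of_inv_mem {S : Subalgebra ℂ A} {a : S}
    (h : ∀ z : ℂ, z ≠ 0 → ∀ u : Aˣ, (u : A) = algebraMap ℂ A z - a → ↑u⁻¹ ∈ S) :
    spectralRadius ℂ a ≤ spectralRadius ℂ (a : A) := by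
  refine iSup₂_le fun z hz => ?_
  rcases eq_or_ne z 0 with rfl | hz0
  · simp
  refine le_iSup₂ (f := fun (w : ℂ) (_ : w ∈ spectrum ℂ (a : A)) => (‖w‖₊ : ℝ≥0∞)) z ?_
  rintro ⟨u, hu⟩
  exact hz ⟨⟨algebraMap ℂ S z - a, ⟨_, h z hz0 u hu⟩, Subtype.ext (by simp [← hu]),
    Subtype.ext (by simp [← hu])⟩, rfl⟩

/-- The elements of an algebra that are absorbed by a pseudo-convex multiplicatively closed set,
the analogue of the elements of finite norm. -/
def absorbedSubalgebra {B : Submonoid A} (hB : Balanced ℂ (B : Set A))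
    (hp : IsPseudoconvex (B : Set A)) : Subalgebra ℂ A where
  carrier := {a | Absorbs ℂ (B : Set A) {a}}
  mul_mem' := by
    intro a b ha hb
    obtain ⟨c, -, ha⟩ := exists_subset_smul_of_absorbs ha
    obtain ⟨d, -, hb⟩ := exists_subset_smul_of_absorbs hb
    have := mul_mem_smul (ha rfl) (hb rfl)
    rw [← Complex.ofReal_mul] at this
    exact absorbs_of_subset_smul hB (singleton_subset_iff.2 this)
  add_mem' := by
    intro a b ha hb
    obtain ⟨α, -, hp⟩ := hp
    obtain ⟨c, -, h⟩ := exists_subset_smul_of_absorbs (Absorbs.union ha hb)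
    exact absorbs_of_subset_smul hB (singleton_subset_iff.2
      (add_mem_smul hp (h (mem_union_left _ rfl)) (h (mem_union_right _ rfl))))
  algebraMap_mem' z := absorbs_of_subset_smul hB (singleton_subset_iff.2 (by
    rw [Algebra.algebraMap_eq_smul_one]
    exact smul_mem_smul hB le_rfl B.one_mem))

theorem units_inv_mem_centralizer {M : Type*} [Monoid M] {s : Set M} {u : Mˣ}
    (h : (u : M) ∈ s.centralizer) : ((u⁻¹ : Mˣ) : M) ∈ s.centralizer := fun x hx =>
  Commute.units_inv_right (h x hx)

theorem resolvent_eq {z : ℂ} (hz : z ≠ 0) {a r : A} (h : r * (algebraMap ℂ A z - a) = 1) :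
    r = z⁻¹ • (1 + r * a) := by
  rw [mul_sub, ← Algebra.commutes, ← Algebra.smul_def] at h
  rw [eq_inv_smul_iff₀ hz, ← h, sub_add_cancel]

/-- The spectral radius formula needs a commutative algebra whose elements are all absorbed by `B`
and which contains the resolvent of `a`: the absorbed part of the bicommutant of `a`. -/
theorem growthBound_of_spectralRadius_lt {B : Submonoid A} (hB : Balanced ℂ (B : Set A))
    (hp : IsPseudoconvex (B : Set A)) {a : A} {ρ : ℝ} (ha : ∀ b, Absorbs ℂ (B : Set A) {b * a})
    (h : spectralRadius ℂ a < ENNReal.ofReal ρ) : GrowthBound B a ρ := by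
  let S := absorbedSubalgebra hB hp ⊓
    Subalgebra.centralizer ℂ (Subalgebra.centralizer ℂ {a} : Set A)
  have haS : a ∈ S := ⟨one_mul a ▸ ha 1, Set.subset_centralizer_centralizer rfl⟩
  have hcomm : ∀ x ∈ S, ∀ y ∈ S, x * y = y * x := fun x hx y hy =>
    Set.centralizer_centralizer_comm_of_comm (S := {a}) (by simp) x hx.2 y hy.2
  have : IsMulCommutative S := .of_comm fun x y => Subtype.ext (hcomm x x.2 y y.2)
  have hrad : spectralRadius ℂ (⟨a, haS⟩ : S) ≤ spectralRadius ℂ a := by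
    refine spectralRadius_le_coe_of_inv_mem fun z hz u hu => ⟨?_, units_inv_mem_centralizer ?_⟩
    · rw [resolvent_eq hz (hu ▸ u.inv_mul : ↑u⁻¹ * (algebraMap ℂ A z - a) = 1)]
      exact Subalgebra.smul_mem _ (add_mem (one_mem _) (ha _)) _
    · rw [hu]
      exact sub_mem (Subalgebra.algebraMap_mem _ z) haS.2
  let f : S →ₗ[ℂ] A := S.val.toLinearMap
  have hS_absorbent : Absorbent ℂ (B.comap S.val : Set S) := absorbent_preimage f fun x => x.2.1
  have hS_balanced : Balanced ℂ (B.comap S.val : Set S) := balanced_preimage hB f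
  have hS_pseudoconvex : IsPseudoconvex (B.comap S.val : Set S) := hp.preimage f
  have hgrowth : GrowthBound (B.comap S.val) ⟨a, haS⟩ ρ :=
    growthBound_of_spectralRadius_lt_of_absorbent hS_balanced hS_pseudoconvex
      hS_absorbent (hrad.trans_lt h)
  exact (growthBound_comap S.val (ENNReal.ofReal_pos.1 (bot_le.trans_lt h))).1 hgrowth

end SpectralRadiusFormula

section Neighborhoods

variable {X : Type*} [AddCommGroup X] [Module ℂ X] [TopologicalSpace X]

theorem locallyPseudoconvex_of_locallyConvexSpace [LocallyConvexSpace ℝ X] :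
    LocallyPseudoconvex X := by
  intro V hV
  obtain ⟨U, ⟨hU, hc⟩, hUV⟩ := (LocallyConvexSpace.convex_basis_zero ℝ X).mem_iff.1 hV
  refine ⟨U, hU, hUV, 2, two_pos, ?_⟩
  have h := hc.add_smul zero_le_one zero_le_one
  rw [one_smul, one_add_one_eq_two] at h
  exact h.ge

variable [ContinuousSMul ℂ X]

theorem LocallyPseudoconvex.exists_balanced (hX : LocallyPseudoconvex X) {V : Set X}
    (hV : V ∈ 𝓝 (0 : X)) :
    ∃ U ∈ 𝓝 (0 : X), U ⊆ V ∧ Balanced ℂ U ∧ IsPseudoconvex U := by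
  obtain ⟨U, hU, hUV, α, hα, h⟩ := hX V hV
  have hα' : (α : ℂ) ≠ 0 := by exact_mod_cast hα.ne'
  have hcore : Balanced ℂ (balancedCore ℂ U) := balancedCore_balanced U
  have hsub : balancedCore ℂ U ⊆ U := balancedCore_subset U
  refine ⟨balancedCore ℂ U, balancedCore_mem_nhds_zero hU, hsub.trans hUV, hcore, α, hα, ?_⟩
  rw [subset_smul_set_iff₀ hα']
  refine ((hcore.add hcore).smul _).subset_balancedCore_of_subset ?_
  rw [← subset_smul_set_iff₀ hα']
  exact (add_subset_add hsub hsub).trans h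

theorem isZeroBase_setOf_balanced {P : Set X → Prop}
    (hsmul : ∀ W, P W → ∀ c : ℂ, c ≠ 0 → P (c • W))
    (hP : ∀ V ∈ 𝓝 (0 : X), ∃ W ∈ 𝓝 (0 : X), W ⊆ V ∧ Balanced ℂ W ∧ P W) :
    IsZeroBase {W : Set X | W ∈ 𝓝 0 ∧ Balanced ℂ W ∧ P W} where
  mem_nhds _ hW := hW.1
  exists_subset V hV := by
    obtain ⟨W, hW, hWV, hb, hPW⟩ := hP V hV
    exact ⟨W, ⟨hW, hb, hPW⟩, hWV⟩
  balanced _ hW := hW.2.1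
  smul_mem W hW c hc :=
    ⟨(set_smul_mem_nhds_zero_iff hc).2 hW.1, hW.2.1.smul c, hsmul W hW.2.2 c hc⟩

end Neighborhoods

section OperatorClasses

variable {X : Type*} [AddCommGroup X] [Module ℂ X] {T R : Module.End ℂ X}

theorem image_smul_subset_smul {W : Set X} {d : ℂ} (h : T '' W ⊆ d • W) (c : ℂ) :
    T '' (c • W) ⊆ d • c • W := by
  rw [image_smul_set, smul_comm]
  exact smul_set_mono h

variable [TopologicalSpace X]

theorem bbBounded_of_continuous (h : Continuous T) : BBBounded T := fun _ hA =>
  hA.image (⟨T, h⟩ : X →L[ℂ] X)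

theorem BBBounded.mul_nbBounded (hR : BBBounded R) (hT : NBBounded T) : NBBounded (R * T) := by
  obtain ⟨U, hU, hTU⟩ := hT
  refine ⟨U, hU, ?_⟩
  rw [Module.End.coe_mul, image_comp]
  exact hR _ hTU

theorem nbBounded_of_isCompactOperator [IsTopologicalAddGroup X] [ContinuousSMul ℂ X]
    (h : IsCompactOperator T) : NBBounded T := by
  obtain ⟨C, hC, hTC⟩ := h
  exact ⟨_, hTC, (hC.isVonNBounded ℂ).subset (image_preimage_subset T C)⟩

theorem NBBoundedModScalar.nnBounded [ContinuousSMul ℂ X] (hX : LocallyPseudoconvex X)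
    (h : NBBoundedModScalar T) : NNBounded T := by
  obtain ⟨z, S, ⟨U, hU, hS⟩, rfl⟩ := h
  refine ⟨_, isZeroBase_setOf_balanced (P := fun W => ∃ α : ℝ, 0 < α ∧
    ⇑(z • 1 + S) '' W ⊆ (α : ℂ) • W) ?_ ?_, fun W hW => hW.2.2⟩
  · rintro W ⟨α, hα, h⟩ c -
    exact ⟨α, hα, image_smul_subset_smul h c⟩
  · intro V hV
    obtain ⟨W, hW, hWUV, hb, α, hα, hp⟩ := hX.exists_balanced (inter_mem hU hV)
    have hWU : W ⊆ U := hWUV.trans inter_subset_left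
    obtain ⟨r, hr, hSr⟩ := exists_subset_smul_of_absorbs (hS.subset (image_mono hWU) hW)
    refine ⟨W, hW, hWUV.trans inter_subset_right, hb, α * max ‖z‖ r,
      mul_pos hα (lt_max_of_lt_right hr), ?_⟩
    rintro _ ⟨x, hx, rfl⟩
    exact add_mem_smul hp (smul_mem_smul hb (le_max_left _ _) hx)
      (smul_subset_smul hb hr.le (le_max_right _ _) (hSr (mem_image_of_mem S hx)))

variable [IsTopologicalAddGroup X] [ContinuousSMul ℂ X]

theorem continuous_of_image_subset_smul
    (h : ∀ V ∈ 𝓝 (0 : X), ∃ U ∈ 𝓝 (0 : X), ∃ c : ℝ, 0 < c ∧ T '' U ⊆ (c : ℂ) • V) :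
    Continuous T := by
  refine continuous_of_continuousAt_zero T fun V hV => ?_
  rw [map_zero] at hV
  obtain ⟨U, hU, c, hc, hT⟩ := h V hV
  have hc' : (c : ℂ) ≠ 0 := by exact_mod_cast hc.ne'
  refine mem_map.2 (mem_of_superset ((set_smul_mem_nhds_zero_iff (inv_ne_zero hc')).2 hU) ?_)
  rwa [← image_subset_iff, image_smul_set, ← subset_smul_set_iff₀ hc']

theorem NNBounded.continuous (h : NNBounded T) : Continuous T := by
  obtain ⟨B, hB, h⟩ := h
  refine continuous_of_image_subset_smul fun V hV => ?_
  obtain ⟨U, hU, hUV⟩ := hB.exists_subset V hV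
  obtain ⟨c, hc, hT⟩ := h U hU
  exact ⟨U, hB.mem_nhds U hU, c, hc, hT.trans (smul_set_mono hUV)⟩

theorem NBBounded.continuous (h : NBBounded T) : Continuous T := by
  obtain ⟨U, hU, h⟩ := h
  exact continuous_of_image_subset_smul fun V hV => ⟨U, hU, exists_subset_smul_of_absorbs (h hV)⟩

end OperatorClasses

section Spectra

variable {X : Type*} [AddCommGroup X] [Module ℂ X]

theorem spectrumIn_anti {P Q : Module.End ℂ X → Prop} (h : ∀ T, P T → Q T) (T : Module.End ℂ X) :
    spectrumIn Q T ⊆ spectrumIn P T :=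
  compl_subset_compl.2 fun _ ⟨R, hl, hr, hR⟩ => ⟨R, hl, hr, h R hR⟩

variable [TopologicalSpace X]

theorem BBBounded.nbBoundedModScalar_of_inverse [ContinuousSMul ℂ X] {K R : Module.End ℂ X}
    (hK : NBBounded K) {z : ℂ} (h : R * (z • 1 - K) = 1) (hR : BBBounded R) :
    NBBoundedModScalar R := by
  have hRK : NBBounded (R * K) := hR.mul_nbBounded hK
  have hscalar (c : ℂ) : BBBounded (c • 1 : Module.End ℂ X) :=
    bbBounded_of_continuous (continuous_const_smul c)
  rcases eq_or_ne z 0 with rfl | hz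
  · have hR_eq : R = (-1 : ℂ) • 1 * (R * (R * K)) := by
      rw [zero_smul, zero_sub, mul_neg] at h
      rw [smul_one_mul, neg_smul, one_smul, ← mul_neg, h, mul_one]
    have hR_nb : NBBounded R := hR_eq ▸ (hscalar (-1)).mul_nbBounded (hR.mul_nbBounded hRK)
    exact ⟨0, R, hR_nb, by rw [zero_smul, zero_add]⟩
  · refine ⟨z⁻¹, z⁻¹ • 1 * (R * K), (hscalar z⁻¹).mul_nbBounded hRK, ?_⟩
    rw [smul_one_mul, ← smul_add]
    exact resolvent_eq hz (by rwa [Algebra.algebraMap_eq_smul_one])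

variable [IsTopologicalAddGroup X]

theorem isUnit_iff_exists_continuous_inverse {T : X →L[ℂ] X} :
    IsUnit T ↔ ∃ R : Module.End ℂ X, R * (T : Module.End ℂ X) = 1 ∧ (T : Module.End ℂ X) * R = 1 ∧
      Continuous R := by
  constructor
  · rintro ⟨u, rfl⟩
    exact ⟨((u⁻¹ : (X →L[ℂ] X)ˣ) : X →L[ℂ] X), congrArg ContinuousLinearMap.toLinearMap u.inv_mul,
      congrArg ContinuousLinearMap.toLinearMap u.mul_inv, ContinuousLinearMap.continuous _⟩
  · rintro ⟨R, hl, hr, hR⟩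
    exact ⟨⟨T, ⟨R, hR⟩, ContinuousLinearMap.coe_injective hr,
      ContinuousLinearMap.coe_injective hl⟩, rfl⟩

variable [ContinuousSMul ℂ X]

theorem NBBounded.spectrum_eq (hX : LocallyPseudoconvex X) {K : Module.End ℂ X}
    (hK : NBBounded K) :
    spectrumBB K = spectrumC K ∧ spectrumC K = spectrumNN K ∧ spectrumNN K = spectrumNB K := by
  have hBB_C : spectrumBB K ⊆ spectrumC K := spectrumIn_anti (fun _ => bbBounded_of_continuous) K
  have hC_NN : spectrumC K ⊆ spectrumNN K := spectrumIn_anti (fun _ => NNBounded.continuous) K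
  have hNN_NB : spectrumNN K ⊆ spectrumNB K :=
    spectrumIn_anti (fun _ => NBBoundedModScalar.nnBounded hX) K
  have hNB_BB : spectrumNB K ⊆ spectrumBB K := compl_subset_compl.2 fun _ ⟨R, hl, hr, hR⟩ =>
    ⟨R, hl, hr, hR.nbBoundedModScalar_of_inverse hK hl⟩
  exact ⟨hBB_C.antisymm (hC_NN.trans (hNN_NB.trans hNB_BB)),
    hC_NN.antisymm (hNN_NB.trans (hNB_BB.trans hBB_C)),
    hNN_NB.antisymm (hNB_BB.trans (hBB_C.trans hC_NN))⟩

theorem spectrumC_coe (T : X →L[ℂ] X) : spectrumC (T : Module.End ℂ X) = spectrum ℂ T := by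
  ext z
  refine not_congr (Iff.trans ?_ isUnit_iff_exists_continuous_inverse.symm)
  rw [Algebra.algebraMap_eq_smul_one]
  rfl

theorem geomRadius_spectrumC_coe (T : X →L[ℂ] X) :
    geomRadius (spectrumC (T : Module.End ℂ X)) = spectralRadius ℂ T := by
  rw [spectrumC_coe]
  rfl

end Spectra

section Radii

variable {X : Type*} [AddCommGroup X] [Module ℂ X]

theorem radiusIn_le {C : (ℕ → Module.End ℂ X) → Prop} {K : Module.End ℂ X} {ν : ℝ} (hν : 0 < ν)
    (h : C fun n => ((ν : ℂ) ^ n)⁻¹ • K ^ n) : radiusIn C K ≤ ENNReal.ofReal ν :=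
  sInf_le ⟨ν, ⟨hν, h⟩, rfl⟩

theorem radiusIn_mono {C D : (ℕ → Module.End ℂ X) → Prop} {K : Module.End ℂ X}
    (h : ∀ ν : ℝ, 0 < ν → C (fun n => ((ν : ℂ) ^ n)⁻¹ • K ^ n) →
      D (fun n => ((ν : ℂ) ^ n)⁻¹ • K ^ n)) : radiusIn D K ≤ radiusIn C K :=
  sInf_le_sInf (image_mono fun ν hν => ⟨hν.1, h ν hν.1 hν.2⟩)

variable [TopologicalSpace X] {S : ℕ → Module.End ℂ X}

theorem NNNull.equicontNull (h : NNNull S) : EquicontNull S := by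
  obtain ⟨B, hB, h⟩ := h
  intro V hV
  obtain ⟨U, hU, hUV⟩ := hB.exists_subset V hV
  exact ⟨U, hB.mem_nhds U hU, fun ε hε => (h U hU ε hε).mono fun n hn =>
    hn.trans (smul_set_mono hUV)⟩

theorem EquicontNull.bbNull (h : EquicontNull S) : BBNull S := by
  intro A hA V hV
  obtain ⟨U, hU, h⟩ := h V hV
  obtain ⟨r, hr, hAU⟩ := exists_subset_smul_of_absorbs (hA hU)
  have hr' : (r : ℂ) ≠ 0 := by exact_mod_cast hr.ne'
  filter_upwards [h r⁻¹ (inv_pos.2 hr)] with n hn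
  calc S n '' A ⊆ S n '' ((r : ℂ) • U) := image_mono hAU
    _ = (r : ℂ) • S n '' U := image_smul_set _ _ _
    _ ⊆ (r : ℂ) • ((r⁻¹ : ℝ) : ℂ) • V := smul_set_mono hn
    _ = V := by rw [Complex.ofReal_inv, smul_inv_smul₀ hr']

variable [ContinuousSMul ℂ X]

theorem NBNull.nnNull (h : NBNull S) : NNNull S := by
  obtain ⟨U, hU, h⟩ := h
  refine ⟨_, isZeroBase_setOf_balanced (P := fun W => ∀ ε : ℝ, 0 < ε →
    ∀ᶠ n in atTop, S n '' W ⊆ (ε : ℂ) • W) ?_ ?_, fun W hW => hW.2.2⟩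
  · intro W h c _ ε hε
    exact (h ε hε).mono fun n hn => image_smul_subset_smul hn c
  · intro V hV
    have hsub : balancedCore ℂ (U ∩ V) ⊆ U ∩ V := balancedCore_subset _
    have hcore : balancedCore ℂ (U ∩ V) ∈ 𝓝 0 := balancedCore_mem_nhds_zero (inter_mem hU hV)
    refine ⟨_, hcore, hsub.trans inter_subset_right, balancedCore_balanced _, fun ε hε => ?_⟩
    have hε' : (ε : ℂ) ≠ 0 := by exact_mod_cast hε.ne'
    filter_upwards [h _ ((set_smul_mem_nhds_zero_iff hε').2 hcore)] with n hn
    exact (image_mono (hsub.trans inter_subset_left)).trans hn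

theorem NBNull.tendsto_apply {S : ℕ → Module.End ℂ X} (h : NBNull S) (x : X) :
    Tendsto (fun n => S n x) atTop (𝓝 0) := fun V hV =>
  (h.nnNull.equicontNull.bbNull {x} (isVonNBounded_singleton x) V hV).mono fun _ hn =>
    hn (mem_image_of_mem _ rfl)

theorem NBNull.smul {S : ℕ → Module.End ℂ X} (h : NBNull S) {c : ℕ → ℂ} (hc : ∀ n, ‖c n‖ ≤ 1) :
    NBNull fun n => c n • S n := by
  obtain ⟨U, hU, h⟩ := h
  refine ⟨U, hU, fun V hV => ?_⟩
  filter_upwards [h _ (balancedCore_mem_nhds_zero (𝕜 := ℂ) hV)] with n hn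
  rintro _ ⟨x, hx, rfl⟩
  exact balancedCore_subset (𝕜 := ℂ) V
    ((balancedCore_balanced V).smul_mem (hc n) (hn (mem_image_of_mem _ hx)))

theorem NBBounded.nbNull_of_bbNull {K : Module.End ℂ X} (hK : NBBounded K) {ν : ℝ} (hν : 0 < ν)
    (h : BBNull fun n => ((ν : ℂ) ^ n)⁻¹ • K ^ n) : NBNull fun n => ((ν : ℂ) ^ n)⁻¹ • K ^ n := by
  obtain ⟨U, hU, hKU⟩ := hK
  refine ⟨U, hU, fun V hV => ?_⟩
  have hν' : (ν : ℂ) ≠ 0 := by exact_mod_cast hν.ne'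
  rw [← map_add_atTop_eq_nat 1, eventually_map]
  filter_upwards [h _ hKU _ ((set_smul_mem_nhds_zero_iff hν').2 hV)] with n hn
  rintro _ ⟨x, hx, rfl⟩
  have hmem : (((ν : ℂ) ^ n)⁻¹ • K ^ n) (K x) ∈ (ν : ℂ) • V :=
    hn (mem_image_of_mem _ (mem_image_of_mem K hx))
  rw [mem_smul_set_iff_inv_smul_mem₀ hν'] at hmem
  rwa [pow_succ, pow_succ, mul_inv_rev, mul_smul]

theorem NBBounded.radius_eq {K : Module.End ℂ X} (hK : NBBounded K) :
    radiusBB K = radiusC K ∧ radiusC K = radiusNN K ∧ radiusNN K = radiusNB K := by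
  have hBB_C : radiusBB K ≤ radiusC K := radiusIn_mono fun _ _ => EquicontNull.bbNull
  have hC_NN : radiusC K ≤ radiusNN K := radiusIn_mono fun _ _ => NNNull.equicontNull
  have hNN_NB : radiusNN K ≤ radiusNB K := radiusIn_mono fun _ _ => NBNull.nnNull
  have hNB_BB : radiusNB K ≤ radiusBB K := radiusIn_mono fun _ hν => hK.nbNull_of_bbNull hν
  exact ⟨hBB_C.antisymm (hC_NN.trans (hNN_NB.trans hNB_BB)),
    hC_NN.antisymm (hNN_NB.trans (hNB_BB.trans hBB_C)),
    hNN_NB.antisymm (hNB_BB.trans (hBB_C.trans hC_NN))⟩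

end Radii

section PowerGrowth

variable {X : Type*} [AddCommGroup X] [Module ℂ X] [TopologicalSpace X] [IsTopologicalAddGroup X]
  {U : Set X}

/-- The continuous operators that map `U` to itself. For a zero neighborhood `U` this submonoid
replaces the unit ball of the operator norm. -/
def mapsToSubmonoid (U : Set X) : Submonoid (X →L[ℂ] X) where
  carrier := {T | MapsTo T U U}
  one_mem' := mapsTo_id U
  mul_mem' := MapsTo.comp

variable [ContinuousSMul ℂ X] {K : X →L[ℂ] X}

theorem mem_smul_mapsToSubmonoid {c : ℂ} (hc : c ≠ 0) {T : X →L[ℂ] X} :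
    T ∈ c • (mapsToSubmonoid U : Set (X →L[ℂ] X)) ↔ T '' U ⊆ c • U := by
  rw [mem_smul_set_iff_inv_smul_mem₀ hc, image_subset_iff]
  exact forall₂_congr fun x _ => (mem_smul_set_iff_inv_smul_mem₀ hc _ _).symm

theorem balanced_mapsToSubmonoid (hU : Balanced ℂ U) :
    Balanced ℂ (mapsToSubmonoid U : Set (X →L[ℂ] X)) := by
  rintro c hc _ ⟨T, hT, rfl⟩ x hx
  exact hU.smul_mem hc (hT hx)

theorem IsPseudoconvex.mapsToSubmonoid (hU : IsPseudoconvex U) :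
    IsPseudoconvex (mapsToSubmonoid U : Set (X →L[ℂ] X)) := by
  obtain ⟨α, hα, h⟩ := hU
  refine ⟨α, hα, ?_⟩
  rintro _ ⟨S, hS, T, hT, rfl⟩
  rw [mem_smul_mapsToSubmonoid (by exact_mod_cast hα.ne')]
  rintro _ ⟨x, hx, rfl⟩
  exact h (add_mem_add (hS hx) (hT hx))

theorem absorbs_mapsToSubmonoid (hU : Balanced ℂ U) {T : X →L[ℂ] X} (h : Absorbs ℂ U (T '' U)) :
    Absorbs ℂ (mapsToSubmonoid U : Set (X →L[ℂ] X)) {T} := by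
  obtain ⟨c, hc, hT⟩ := exists_subset_smul_of_absorbs h
  have hc' : (c : ℂ) ≠ 0 := by exact_mod_cast hc.ne'
  exact absorbs_of_subset_smul (balanced_mapsToSubmonoid hU)
    (singleton_subset_iff.2 ((mem_smul_mapsToSubmonoid hc').2 hT))

theorem GrowthBound.nbNull (hU : U ∈ 𝓝 (0 : X)) (hK : IsVonNBounded ℂ (K '' U)) {ρ ν : ℝ}
    (hρ : 0 < ρ) (h : GrowthBound (mapsToSubmonoid U) K ρ) (hρν : ρ < ν) :
    NBNull fun n => ((ν : ℂ) ^ n)⁻¹ • (K : Module.End ℂ X) ^ n := by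
  obtain ⟨M, -, h⟩ := h
  have hν : 0 < ν := hρ.trans hρν
  have hlim : Tendsto (fun n : ℕ => M / ν * (ρ / ν) ^ n) atTop (𝓝 (M / ν * 0)) :=
    (tendsto_pow_atTop_nhds_zero_of_lt_one (by positivity) ((div_lt_one hν).2 hρν)).const_mul _
  rw [mul_zero] at hlim
  have hlim_smul : Tendsto (fun n : ℕ => ((M / ν * (ρ / ν) ^ n : ℝ) : ℂ) • K '' U) atTop
      (𝓝 0).smallSets :=
    hK.tendsto_smallSets_nhds.comp
      ((Complex.continuous_ofReal.tendsto' 0 0 Complex.ofReal_zero).comp hlim)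
  refine ⟨U, hU, fun V hV => ?_⟩
  rw [← map_add_atTop_eq_nat 1, eventually_map]
  filter_upwards [hlim_smul.eventually (eventually_smallSets_subset.2 hV)] with n hn
  obtain ⟨T, hT, hTK⟩ := h n
  refine Subset.trans ?_ hn
  rintro _ ⟨x, hx, rfl⟩
  refine ⟨K (T x), mem_image_of_mem K (hT hx), ?_⟩
  have hpow : ((K : Module.End ℂ X) ^ n) x = ((M * ρ ^ n : ℝ) : ℂ) • T x := by
    rw [← ContinuousLinearMap.toLinearMap_pow, ← hTK]
    rfl
  have hcoeff : ((M / ν * (ρ / ν) ^ n : ℝ) : ℂ) =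
      ((ν : ℂ) ^ (n + 1))⁻¹ * ((M * ρ ^ n : ℝ) : ℂ) := by
    push_cast
    rw [div_pow, pow_succ, mul_inv_rev]
    ring
  rw [LinearMap.smul_apply, pow_succ' (K : Module.End ℂ X), Module.End.mul_apply, hpow, map_smul,
    smul_smul, ← hcoeff]
  rfl

theorem radiusNB_le_spectralRadius (hX : LocallyPseudoconvex X)
    (hK : NBBounded (K : Module.End ℂ X)) :
    radiusNB (K : Module.End ℂ X) ≤ spectralRadius ℂ K := by
  obtain ⟨U₀, hU₀, hKU₀⟩ := hK
  obtain ⟨U, hU, hUU₀, hb, hp⟩ := hX.exists_balanced hU₀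
  have hKU : IsVonNBounded ℂ (K '' U) := hKU₀.subset (image_mono hUU₀)
  have hmulK (R : X →L[ℂ] X) : Absorbs ℂ (mapsToSubmonoid U : Set (X →L[ℂ] X)) {R * K} := by
    refine absorbs_mapsToSubmonoid hb ?_
    rw [ContinuousLinearMap.mul_def, ContinuousLinearMap.coe_comp, image_comp]
    exact hKU.image R hU
  refine le_of_forall_gt_imp_ge_of_dense fun r hr => ?_
  obtain ⟨ρ, hρ, hlt⟩ := ENNReal.lt_iff_exists_nnreal_btwn.1 hr
  obtain ⟨ν, hρν, hνr⟩ := ENNReal.lt_iff_exists_nnreal_btwn.1 hlt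
  have hρ0 : (0 : ℝ) < ρ := NNReal.coe_pos.2 (ENNReal.coe_pos.1 (bot_le.trans_lt hρ))
  have hgrowth : GrowthBound (mapsToSubmonoid U) K ρ :=
    growthBound_of_spectralRadius_lt (B := mapsToSubmonoid U) (balanced_mapsToSubmonoid hb)
      hp.mapsToSubmonoid hmulK (by rwa [ENNReal.ofReal_coe_nnreal])
  have hρν' : (ρ : ℝ) < ν := by exact_mod_cast hρν
  refine (radiusIn_le (hρ0.trans hρν') (hgrowth.nbNull hU hKU hρ0 hρν')).trans ?_
  rw [ENNReal.ofReal_coe_nnreal]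
  exact hνr.le

end PowerGrowth

section Neumann

theorem isUnit_one_sub_of_pow {A : Type*} [Ring A] {a : A} {n : ℕ} (h : IsUnit (1 - a ^ n)) :
    IsUnit (1 - a) := by
  rw [← mul_neg_geom_sum] at h
  have hcomm : Commute (1 - a) (∑ i ∈ Finset.range n, a ^ i) :=
    (Commute.one_left _).sub_left (.sum_right _ _ _ fun i _ => .self_pow a i)
  exact (hcomm.isUnit_mul_iff.1 h).1

variable {X : Type*} [AddCommGroup X] [Module ℂ X] [TopologicalSpace X]
  [IsTopologicalAddGroup X] {P T : X →L[ℂ] X}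

/-- A cluster point of the Neumann series takes the place of its sum. -/
theorem exists_sub_apply_eq [T2Space X] {C : Set X} (hC : IsCompact C) {x : X}
    (hmem : ∀ n, (∑ i ∈ Finset.range (n + 1), P ^ i) x ∈ C)
    (hlim : Tendsto (fun n => (P ^ n) x) atTop (𝓝 0)) : ∃ y ∈ C, y - P y = x := by
  obtain ⟨y, hy, hcluster⟩ := hC.exists_mapClusterPt (f := atTop)
    (le_principal_iff.2 (mem_map.2 (univ_mem' hmem)))
  have hcluster' := hcluster.continuousAt_comp (1 - P : X →L[ℂ] X).continuous.continuousAt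
  have htendsto : Tendsto (⇑(1 - P) ∘ fun n => (∑ i ∈ Finset.range (n + 1), P ^ i) x) atTop
      (𝓝 x) := by
    have hgeom (n : ℕ) : (1 - P) ((∑ i ∈ Finset.range (n + 1), P ^ i) x) = x - (P ^ (n + 1)) x :=
      DFunLike.congr_fun (mul_neg_geom_sum P (n + 1)) x
    have hsub := (tendsto_const_nhds (x := x)).sub (hlim.comp (tendsto_add_atTop_nat 1))
    rw [sub_zero] at hsub
    exact hsub.congr fun n => (hgeom n).symm
  exact ⟨y, hy, eq_of_nhds_neBot (hcluster'.neBot.mono (inf_le_inf_left _ htendsto))⟩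

theorem geom_sum_succ_apply (P : X →L[ℂ] X) (n : ℕ) (x : X) :
    (∑ i ∈ Finset.range (n + 1), P ^ i) x = x + P ((∑ i ∈ Finset.range n, P ^ i) x) := by
  rw [geom_sum_succ, add_comm]
  rfl

theorem geom_sum_apply_mem_smul {U : Set X} (h0 : (0 : X) ∈ U) {α : ℝ}
    (hα : U + U ⊆ (α : ℂ) • U) (hP : MapsTo P ((α : ℂ) • U) U) {x : X} (hx : x ∈ U) (n : ℕ) :
    (∑ i ∈ Finset.range n, P ^ i) x ∈ (α : ℂ) • U := by
  induction n with
  | zero => exact ⟨0, h0, by simp⟩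
  | succ n ih =>
    rw [geom_sum_succ_apply]
    exact hα (add_mem_add hx (hP ih))

theorem one_sub_injective [T2Space X] (hlim : ∀ x, Tendsto (fun n => (P ^ n) x) atTop (𝓝 0)) :
    Function.Injective (1 - P : X →L[ℂ] X) := by
  refine (injective_iff_map_eq_zero _).2 fun y hy => ?_
  have hPy : Function.IsFixedPt P y := (sub_eq_zero.1 hy).symm
  have hpow (n : ℕ) : (P ^ n) y = y := by
    simp only [pow_apply_eq_iterate, (hPy.iterate n).eq]
  exact tendsto_nhds_unique tendsto_const_nhds ((hlim y).congr hpow)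

variable [ContinuousSMul ℂ X] [T2Space X]

theorem isUnit_one_sub_of_mapsTo {U C : Set X} (hU : U ∈ 𝓝 (0 : X)) {α : ℝ}
    (hα : U + U ⊆ (α : ℂ) • U) (hPU : MapsTo P ((α : ℂ) • U) U) (hC : IsCompact C)
    (hPC : MapsTo P U C) (hlim : ∀ x, Tendsto (fun n => (P ^ n) x) atTop (𝓝 0)) :
    IsUnit (1 - P) := by
  have hC' : IsCompact ((α : ℂ) • C) := hC.smul _
  have hsol (x : X) (hx : x ∈ U) : ∃ y, (1 - P) y = x ∧ y - x ∈ (α : ℂ) • C := by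
    have hmem (n : ℕ) : (∑ i ∈ Finset.range (n + 1), P ^ i) x ∈ (x + ·) '' ((α : ℂ) • C) := by
      obtain ⟨u, hu, hux⟩ := geom_sum_apply_mem_smul (mem_of_mem_nhds hU) hα hPU hx n
      have hP : P ((∑ i ∈ Finset.range n, P ^ i) x) = (α : ℂ) • P u := by rw [← hux, ← map_smul]
      rw [geom_sum_succ_apply, hP]
      exact mem_image_of_mem _ (smul_mem_smul_set (hPC hu))
    obtain ⟨_, ⟨v, hv, rfl⟩, hy⟩ :=
      exists_sub_apply_eq (hC'.image (continuous_const_add x)) hmem (hlim x)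
    exact ⟨x + v, hy, by simpa using hv⟩
  have hinj : Function.Injective (1 - P : X →L[ℂ] X) := one_sub_injective hlim
  have hsurj : Function.Surjective (1 - P : X →L[ℂ] X) := by
    intro x
    obtain ⟨r, -, hxr⟩ := exists_subset_smul_of_absorbs (absorbent_nhds_zero (𝕜 := ℂ) hU x)
    obtain ⟨u, hu, rfl⟩ := hxr rfl
    obtain ⟨y, hy, -⟩ := hsol u hu
    exact ⟨(r : ℂ) • y, by rw [map_smul, hy]⟩
  let e := LinearEquiv.ofBijective ((1 - P : X →L[ℂ] X) : Module.End ℂ X) ⟨hinj, hsurj⟩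
  have hsub : NBBounded ((e.symm : Module.End ℂ X) - 1) := by
    refine ⟨U, hU, (hC'.isVonNBounded ℂ).subset (image_subset_iff.2 fun x hx => ?_)⟩
    obtain ⟨y, hy, hyx⟩ := hsol x hx
    have hey : e.symm x = y := e.symm_apply_eq.2 hy.symm
    simpa [hey] using hyx
  refine isUnit_iff_exists_continuous_inverse.2 ⟨e.symm, LinearMap.ext e.symm_apply_apply,
    LinearMap.ext e.apply_symm_apply, ?_⟩
  exact (hsub.continuous.add continuous_id).congr fun x => sub_add_cancel (e.symm x) x

theorem isUnit_one_sub_of_nbNull_pow (hX : LocallyPseudoconvex X) (hT : IsCompactOperator T)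
    (h : NBNull fun n => ((T ^ n : X →L[ℂ] X) : Module.End ℂ X)) : IsUnit (1 - T) := by
  obtain ⟨C, hC, hTC⟩ := hT
  have hlim : ∀ x, Tendsto (fun n => (T ^ n) x) atTop (𝓝 0) := h.tendsto_apply
  obtain ⟨U₀, hU₀, hnull⟩ := h
  obtain ⟨U, hU, hUsub, α, hα, hUα⟩ := hX _ (inter_mem hU₀ hTC)
  have hα' : (α : ℂ) ≠ 0 := by exact_mod_cast hα.ne'
  obtain ⟨m, hm⟩ : ∃ m : ℕ, ⇑(T ^ (m + 1)) '' U₀ ⊆ (α : ℂ)⁻¹ • U :=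
    (((tendsto_add_atTop_nat 1).eventually
      (hnull _ ((set_smul_mem_nhds_zero_iff (inv_ne_zero hα')).2 hU)))).exists
  refine isUnit_one_sub_of_pow (n := m + 1) (isUnit_one_sub_of_mapsTo hU hUα
    (C := (T ^ m) '' C) ?_ (hC.image (T ^ m).continuous) ?_ fun x => ?_)
  · rintro _ ⟨x, hx, rfl⟩
    have hTx : (T ^ (m + 1)) x ∈ (α : ℂ)⁻¹ • U := hm (mem_image_of_mem _ (hUsub hx).1)
    rwa [mem_smul_set_iff_inv_smul_mem₀ (inv_ne_zero hα'), inv_inv, ← map_smul] at hTx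
  · intro x hx
    rw [pow_succ]
    exact mem_image_of_mem _ (hUsub hx).2
  · simp only [← pow_mul]
    exact (hlim x).comp (tendsto_id.const_mul_atTop' m.succ_pos)

theorem norm_le_of_mem_spectrum (hX : LocallyPseudoconvex X) {K : X →L[ℂ] X}
    (hK : IsCompactOperator K) {ν : ℝ} (hν : 0 < ν)
    (hnull : NBNull fun n => ((ν : ℂ) ^ n)⁻¹ • (K : Module.End ℂ X) ^ n) {z : ℂ}
    (hz : z ∈ spectrum ℂ K) : ‖z‖ ≤ ν := by
  by_contra! hlt
  refine hz ?_
  have hz0 : z ≠ 0 := norm_pos_iff.1 (hν.trans hlt)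
  have hν' : (ν : ℂ) ≠ 0 := by exact_mod_cast hν.ne'
  have hratio (n : ℕ) : ‖(ν / z) ^ n‖ ≤ 1 := by
    rw [norm_pow, norm_div, Complex.norm_real, Real.norm_of_nonneg hν.le]
    exact pow_le_one₀ (by positivity) ((div_le_one (hν.trans hlt)).2 hlt.le)
  have hpow (n : ℕ) : (ν / z) ^ n • ((ν : ℂ) ^ n)⁻¹ • (K : Module.End ℂ X) ^ n =
      (((z⁻¹ • K) ^ n : X →L[ℂ] X) : Module.End ℂ X) := by
    rw [ContinuousLinearMap.toLinearMap_pow, ContinuousLinearMap.toLinearMap_smul, smul_pow,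
      smul_smul, div_pow, inv_pow]
    congr 1
    field_simp
  have hunit : IsUnit (1 - z⁻¹ • K) :=
    isUnit_one_sub_of_nbNull_pow hX (hK.smul z⁻¹) (by simpa only [hpow] using hnull.smul hratio)
  have hfactor : algebraMap ℂ (X →L[ℂ] X) z - K = z • (1 - z⁻¹ • K) := by
    rw [smul_sub, smul_inv_smul₀ hz0, Algebra.algebraMap_eq_smul_one]
  rw [spectrum.mem_resolventSet_iff, hfactor]
  exact hunit.smul (Units.mk0 z hz0)

theorem spectralRadius_le_radiusNB (hX : LocallyPseudoconvex X) {K : X →L[ℂ] X}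
    (hK : IsCompactOperator K) : spectralRadius ℂ K ≤ radiusNB (K : Module.End ℂ X) := by
  refine le_sInf ?_
  rintro _ ⟨ν, ⟨hν, hnull⟩, rfl⟩
  refine iSup₂_le fun z hz => ?_
  rw [← enorm_eq_nnnorm, ← ofReal_norm]
  exact ENNReal.ofReal_le_ofReal (norm_le_of_mem_spectrum hX hK hν hnull hz)

end Neumann

end TVSOp

theorem mainTheorem3 {X : Type*} [AddCommGroup X] [Module ℂ X] [TopologicalSpace X]
    [IsTopologicalAddGroup X] [ContinuousSMul ℂ X] [T2Space X]
    (hX : LocallyConvexSpace ℝ X ∨ TVSOp.LocallyPseudoconvex X)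
    (K : Module.End ℂ X) (hK : IsCompactOperator K) :
    (TVSOp.spectrumBB K = TVSOp.spectrumC K ∧ TVSOp.spectrumC K = TVSOp.spectrumNN K ∧
      TVSOp.spectrumNN K = TVSOp.spectrumNB K) ∧
    (TVSOp.radiusBB K = TVSOp.radiusC K ∧ TVSOp.radiusC K = TVSOp.radiusNN K ∧
      TVSOp.radiusNN K = TVSOp.radiusNB K) ∧
    TVSOp.radiusNB K = TVSOp.geomRadius (TVSOp.spectrumNB K) := by
  have hX' : TVSOp.LocallyPseudoconvex X :=
    hX.elim (fun _ => TVSOp.locallyPseudoconvex_of_locallyConvexSpace) id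
  have hKnb : TVSOp.NBBounded K := TVSOp.nbBounded_of_isCompactOperator hK
  have hspectrum := hKnb.spectrum_eq hX'
  refine ⟨hspectrum, hKnb.radius_eq, ?_⟩
  rw [← hspectrum.2.2, ← hspectrum.2.1]
  let K' : X →L[ℂ] X := ⟨K, hKnb.continuous⟩
  calc TVSOp.radiusNB K = spectralRadius ℂ K' :=
        (TVSOp.radiusNB_le_spectralRadius hX' (K := K') hKnb).antisymm
          (TVSOp.spectralRadius_le_radiusNB hX' (K := K') hK)
    _ = TVSOp.geomRadius (TVSOp.spectrumC K) := (TVSOp.geomRadius_spectrumC_coe K').symm
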